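/- Let $K$ be a field, let $n\ge 1$ and $a_1,\dots,a_n\ge 1$ be integers, and let $X=(x_{i_1,\dots,i_n})$, where $1\le i_t\le a_t$, be the $n$-dimensional tensor of type $a_1\times\cdots\times a_n$ whose entries are independent variables; write $K[X]$ for the polynomial ring over $K$ in these variables. For $1\le j\le n$, a $j$-th flattening matrix of $X$ is an $a_j\times\prod_{i\ne j}a_i$ matrix that contains all the variables and each of whose columns has the form $(x_{i_1,\dots,i_{j-1},t,i_{j+1},\dots,i_n})_{t=1,\dots,a_j}$ with fixed indices $i_s$, $s\ne j$. For a matrix $A$ and a positive integer $u$ let $D_u(A)$ be the set of all $u$-minors of $A$ (which is empty if $u$ exceeds the number of rows or of columns). A finite set $\mathcal G\subset K[X]$ is a Gröbner basis (of the ideal it generates) with respect to a monomial order if the leading terms of the elements of $\mathcal G$ generate the initial ideal of the ideal $\langle\mathcal G\rangle$. Then for any $j,k\in\{1,\dots,n\}$ (possibly equal) and any positive integers $u_j,u_k$, there exist a $j$-th flattening matrix $X_j$ of $X$, a $k$-th flattening matrix $X_k$ of $X$ and a monomial order on $K[X]$ such that $D_{u_j}(X_j)\cup D_{u_k}(X_k)$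 is a Gröbner basis with respect to that order. -/

import Mathlib

open MvPolynomial

/-- An `n`-dimensional tensor of type `a 0 × ⋯ × a (n - 1)` with entries in `R`. -/
abbrev Tensor {n : ℕ} (a : Fin n → ℕ) (R : Type*) : Type _ :=
  ((i : Fin n) → Fin (a i)) → R

/-- The tensor of variables of type `a`: its entry at the multi-index `s` is the variable `x_s` of
the polynomial ring over `K` whose variables are indexed by all multi-indices. -/
noncomputable def tensorOfVariables {n : ℕ} (a : Fin n → ℕ) (K : Type*) [Field K] :
    Tensor a (MvPolynomial ((i : Fin n) → Fin (a i)) K) :=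
  fun s => X s

/-- `M` is a `j`-th flattening matrix of the tensor `T`: it has `a j` rows and `∏_{i ≠ j} a i`
columns, every column is obtained by letting the `j`-th index run from its first to its last value
while all the other indices stay fixed, and every entry of `T` occurs in `M`. -/
def IsFlattening {n : ℕ} {a : Fin n → ℕ} {R : Type*} (T : Tensor a R) (j : Fin n)
    (M : Matrix (Fin (a j)) (Fin (∏ i ∈ Finset.univ.erase j, a i)) R) : Prop :=
  (∀ q, ∃ s : (i : Fin n) → Fin (a i), ∀ p, M p q = T (Function.update s j p)) ∧
    ∀ s : (i : Fin n) → Fin (a i), ∃ p q, M p q = T s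

/-- The set `D_u(M)` of the `u`-minors of `M`: the determinants of the `u × u` submatrices of `M`
(the rows and the columns being taken in increasing order). -/
def minors {p q : ℕ} {R : Type*} [CommRing R] (u : ℕ) (M : Matrix (Fin p) (Fin q) R) : Set R :=
  {f | ∃ (r : Fin u ↪o Fin p) (c : Fin u ↪o Fin q), f = (M.submatrix r c).det}

/-- The finite set `G` is a Gröbner basis (of the ideal it generates) with respect to the monomial
order `m`: the leading terms of the elements of `G` generate the initial ideal of the ideal
generated by `G`. -/
def IsGroebnerBasis {σ K : Type*} [Field K] (m : MonomialOrder σ)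
    (G : Set (MvPolynomial σ K)) : Prop :=
  G.Finite ∧
    Ideal.span (m.leadingTerm '' G) =
      Ideal.span (m.leadingTerm '' (Ideal.span G : Set (MvPolynomial σ K)))

/-!
The Gröbner property is read off from a parametrization. Put `α s = s j`, `β s = s k`, let `γ`
number the remaining coordinates, and order the variables lexicographically by `(γ, α, β)`, small
indices being large variables. If the columns of the two flattening matrices are sorted compatibly,
the variables decrease along the rows and columns of both, so the leading term of a minor is its
diagonal (`leadingTerm_det`). The diagonals are the chains of `ChainRel α β γ` for the first matrix
and of `ChainRel β α γ` for the second.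

With `U = u - 1` and `V = v - 1`, the minors vanish under the Tucker parametrization
`x_p ↦ ∑ i < U, ∑ l < V, y_{α p, i} z_{β p, l} w_{i, l, γ p}`. It therefore suffices
(`isGroebnerBasis_of_forall_ker`) that every nonzero `f` in the kernel of this substitution has a
leading monomial `M` divisible by a chain of `U + 1` variables of the first kind or `V + 1` of the
second (`exists_chain_of_tucker_eq_zero`). If it is not, label each variable `p` of `M` by its
levels `(s p, t p)`, the numbers of steps of the longest chains of the two kinds in `M` that end
at `p`; then `s p < U` and `t p < V`. The labelled monomial `∏ y_{α p, s p} z_{β p, t p}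
w_{s p, t p, γ p}` occurs in the image of `M` with coefficient one, and in the image of no other
monomial of `f`: any labelled monomial with the same content is lexicographically at least `M`, with
equality only for the labelling by levels (`eq_of_sameMarginal_of_isLevel`). So the image of `f`
contains it with coefficient the leading coefficient of `f`, and is nonzero, in any characteristic.

The minimality of `M` is a counting argument. Points of equal first level form an antichain, so
sets `{c ≤ α}` and `{γ < κ}` are nested there, and their overlap is as heavy as the content permits
(`mass_inter_le_of_nested`). Inside a layer of `γ` the two levels are correlated
(`IsLevel.le_of_antitone`), so that `{c ≤ α}` is also nested with lower sets of labels.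
Inclusion-exclusion over the labels dominated by those of the rectangle `{α < c, β < d}` then shows
that, once the earlier layers agree, the rectangle is as light as possible for `M`
(`mass_rectangle_le`), which decides the lexicographic comparison. If `j = k`, the same argument
applies with `β = 0`, `V = 1` and `U = min u v - 1`.
-/

/-! ### Weights with prescribed marginals -/

section Mass
variable {Ω : Type*} [Fintype Ω]

open Classical in
/-- The total weight that `E` gives to the points satisfying `Q`. -/
noncomputable def mass (E : Ω → ℕ) (Q : Ω → Prop) : ℕ := ∑ x, if Q x then E x else 0

theorem mass_mono {E : Ω → ℕ} {Q R : Ω → Prop} (h : ∀ x, E x ≠ 0 → Q x → R x) :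
    mass E Q ≤ mass E R := by
  classical
  refine Finset.sum_le_sum fun x _ => ?_
  have := h x
  split_ifs <;> grind

theorem mass_congr {E : Ω → ℕ} {Q R : Ω → Prop} (h : ∀ x, E x ≠ 0 → (Q x ↔ R x)) :
    mass E Q = mass E R :=
  le_antisymm (mass_mono fun x hx => (h x hx).1) (mass_mono fun x hx => (h x hx).2)

theorem mass_split (E : Ω → ℕ) (Q R : Ω → Prop) :
    mass E Q = mass E (fun x => Q x ∧ R x) + mass E (fun x => Q x ∧ ¬ R x) := by
  classical
  simp only [mass]
  rw [← Finset.sum_add_distrib]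
  refine Finset.sum_congr rfl fun x _ => ?_
  by_cases hQ : Q x <;> by_cases hR : R x <;> simp [hQ, hR]

theorem mass_eq_sum (E : Ω → ℕ) (Q : Ω → Prop) (s : Ω → ℕ) {N : ℕ} (hs : ∀ x, s x < N) :
    mass E Q = ∑ i ∈ Finset.range N, mass E (fun x => s x = i ∧ Q x) := by
  classical
  simp only [mass]
  rw [Finset.sum_comm]
  refine Finset.sum_congr rfl fun x _ => ?_
  by_cases hQ : Q x <;> simp [hQ, hs x]

theorem eq_zero_of_mass_eq_zero {E : Ω → ℕ} {Q : Ω → Prop} (h : mass E Q = 0) {x : Ω}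
    (hx : Q x) : E x = 0 := by
  classical
  have := (Finset.sum_eq_zero_iff.1 h) x (Finset.mem_univ x)
  simpa [hx] using this

/-- The weights `E` and `E'` on `Ω` have the same image under `f`; this is phrased by
integrating all functions of `f`. -/
def SameMarginal {τ : Type*} (f : Ω → τ) (E' E : Ω → ℕ) : Prop :=
  ∀ g : τ → ℕ, ∑ x, E' x * g (f x) = ∑ x, E x * g (f x)

theorem SameMarginal.mass_eq {τ : Type*} {f : Ω → τ} {E' E : Ω → ℕ} (h : SameMarginal f E' E)
    (Q : τ → Prop) : mass E' (fun x => Q (f x)) = mass E (fun x => Q (f x)) := by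
  classical
  have := h (fun y => if Q y then 1 else 0)
  simpa [mass] using this

/-- If two sets are nested on the support of `E`, then their intersection is as heavy as it can
be: it is at least as heavy as for any weight `E'` giving no more weight to each of the two. -/
theorem mass_inter_le_of_nested {E' E : Ω → ℕ} {Q R : Ω → Prop}
    (hQ : mass E' Q ≤ mass E Q) (hR : mass E' R ≤ mass E R)
    (hnest : ∀ x y, E x ≠ 0 → E y ≠ 0 → Q x → ¬ R x → R y → ¬ Q y → False) :
    mass E' (fun x => Q x ∧ R x) ≤ mass E (fun x => Q x ∧ R x) := by
  by_cases h : ∃ x, E x ≠ 0 ∧ Q x ∧ ¬ R x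
  · obtain ⟨x, hx, hxQ, hxR⟩ := h
    calc _ ≤ mass E' R := mass_mono fun _ _ h => h.2
      _ ≤ mass E R := hR
      _ ≤ _ := mass_mono fun y hy hyR => ⟨by_contra fun hyQ => hnest x y hx hy hxQ hxR hyR hyQ, hyR⟩
  · push Not at h
    calc _ ≤ mass E' Q := mass_mono fun _ _ h => h.1
      _ ≤ mass E Q := hQ
      _ ≤ _ := mass_mono fun y hy hyQ => ⟨hyQ, h y hy hyQ⟩

variable {a b k s t : Ω → ℕ} {E' E : Ω → ℕ}

/-- If the points of equal label `s` form an antichain for `a` and `k` on the support of `E`, then on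
each label the part with large `a` and small `k` is as heavy as it can be. -/
theorem mass_slice_lt_le
    (hanti : ∀ x y, E x ≠ 0 → E y ≠ 0 → s x = s y → a x < a y → k y ≤ k x)
    (ha : SameMarginal (fun x => (a x, s x)) E' E)
    (hw : SameMarginal (fun x => (s x, t x, k x)) E' E) (i c κ : ℕ) :
    mass E' (fun x => (s x = i ∧ c ≤ a x) ∧ (s x = i ∧ k x < κ)) ≤
      mass E (fun x => (s x = i ∧ c ≤ a x) ∧ (s x = i ∧ k x < κ)) := by
  refine mass_inter_le_of_nested (ha.mass_eq fun y => y.2 = i ∧ c ≤ y.1).le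
    (hw.mass_eq fun y => y.1 = i ∧ y.2.2 < κ).le ?_
  intro x y hx hy h1 h2 h3 h4
  have := hanti y x hy hx (by omega) (by omega)
  omega

/-- Agreement below `κ`, summed over the labels, forces agreement for each label, because the
inequality of `mass_slice_lt_le` holds label by label. Subtraction leaves the layer `κ`. -/
theorem mass_slice_eq_le
    (hanti : ∀ x y, E x ≠ 0 → E y ≠ 0 → s x = s y → a x < a y → k y ≤ k x)
    (ha : SameMarginal (fun x => (a x, s x)) E' E)
    (hw : SameMarginal (fun x => (s x, t x, k x)) E' E) {κ N : ℕ} (hs : ∀ x, s x < N)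
    (hlow : ∀ c, mass E' (fun x => c ≤ a x ∧ k x < κ) = mass E (fun x => c ≤ a x ∧ k x < κ))
    (i c : ℕ) :
    mass E' (fun x => s x = i ∧ k x = κ ∧ c ≤ a x) ≤
      mass E (fun x => s x = i ∧ k x = κ ∧ c ≤ a x) := by
  have form (F : Ω → ℕ) (i κ : ℕ) :
      mass F (fun x => (s x = i ∧ c ≤ a x) ∧ (s x = i ∧ k x < κ)) =
        mass F (fun x => s x = i ∧ c ≤ a x ∧ k x < κ) :=
    mass_congr fun x _ => by tauto
  have hle (i κ : ℕ) : mass E' (fun x => s x = i ∧ c ≤ a x ∧ k x < κ) ≤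
      mass E (fun x => s x = i ∧ c ≤ a x ∧ k x < κ) := by
    rw [← form, ← form]; exact mass_slice_lt_le hanti ha hw i c κ
  by_cases hi : i < N
  · have heq : mass E' (fun x => s x = i ∧ c ≤ a x ∧ k x < κ) =
        mass E (fun x => s x = i ∧ c ≤ a x ∧ k x < κ) := by
      have hsum := hlow c
      rw [mass_eq_sum E' _ s hs, mass_eq_sum E _ s hs] at hsum
      exact (Finset.sum_eq_sum_iff_of_le fun i _ => hle i κ).1 hsum i (Finset.mem_range.2 hi)
    have hsucc (F : Ω → ℕ) : mass F (fun x => s x = i ∧ c ≤ a x ∧ k x < κ + 1) =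
        mass F (fun x => s x = i ∧ c ≤ a x ∧ k x < κ) +
          mass F (fun x => s x = i ∧ k x = κ ∧ c ≤ a x) := by
      rw [mass_split F (fun x => s x = i ∧ c ≤ a x ∧ k x < κ + 1) (fun x => k x < κ)]
      congr 1 <;> exact mass_congr fun x _ => by constructor <;> intro h <;> omega
    have := hle i (κ + 1)
    rw [hsucc, hsucc] at this
    omega
  · refine mass_mono (fun x _ h => absurd (hs x) ?_) |>.trans (b := mass E' fun _ => False) ?_
    · omega
    · simp [mass]

/-- Within a layer, the part of a lower set of labels with large `a` is as heavy as it can be: in each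
row of labels, `t` decreases with `a` on the support of `E`. -/
theorem mass_lowerSet_le
    (hanti : ∀ x y, E x ≠ 0 → E y ≠ 0 → s x = s y → a x < a y → k y ≤ k x)
    (hlab : ∀ x y, E x ≠ 0 → E y ≠ 0 → s x = s y → k x = k y → a x < a y → t y ≤ t x)
    (ha : SameMarginal (fun x => (a x, s x)) E' E)
    (hw : SameMarginal (fun x => (s x, t x, k x)) E' E) {κ N : ℕ} (hs : ∀ x, s x < N)
    (hlow : ∀ c, mass E' (fun x => c ≤ a x ∧ k x < κ) = mass E (fun x => c ≤ a x ∧ k x < κ))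
    {D : ℕ → ℕ → Prop} (hD : ∀ i l l', D i l → l' ≤ l → D i l') (c : ℕ) :
    mass E' (fun x => (k x = κ ∧ D (s x) (t x)) ∧ c ≤ a x) ≤
      mass E (fun x => (k x = κ ∧ D (s x) (t x)) ∧ c ≤ a x) := by
  rw [mass_eq_sum E' _ s hs, mass_eq_sum E _ s hs]
  refine Finset.sum_le_sum fun i _ => ?_
  have form (F : Ω → ℕ) :
      mass F (fun x => s x = i ∧ (k x = κ ∧ D (s x) (t x)) ∧ c ≤ a x) =
        mass F (fun x => (s x = i ∧ k x = κ ∧ c ≤ a x) ∧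
          (s x = i ∧ k x = κ ∧ D (s x) (t x))) :=
    mass_congr fun x _ => by tauto
  rw [form, form]
  refine mass_inter_le_of_nested (mass_slice_eq_le hanti ha hw hs hlow i c)
    (hw.mass_eq fun y => y.1 = i ∧ y.2.2 = κ ∧ D y.1 y.2.1).le ?_
  rintro x y hx hy ⟨h1, h2, h3⟩ h4 ⟨h5, h6, h7⟩ h8
  have := hlab y x hy hx (by omega) (by omega) (by omega)
  exact h4 ⟨h1, h2, hD _ _ _ (by rw [h1, ← h5]; exact h7) this⟩

/-- Rectangles at the bottom of a layer are lightest for `E`. The label set `D` has to contain the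
labels of the rectangle, and its points have to avoid the opposite quadrant. -/
theorem mass_rectangle_le
    (hanti : ∀ x y, E x ≠ 0 → E y ≠ 0 → s x = s y → a x < a y → k y ≤ k x)
    (hlab : ∀ x y, E x ≠ 0 → E y ≠ 0 → s x = s y → k x = k y → a x < a y → t y ≤ t x)
    (hanti' : ∀ x y, E x ≠ 0 → E y ≠ 0 → t x = t y → b x < b y → k y ≤ k x)
    (hlab' : ∀ x y, E x ≠ 0 → E y ≠ 0 → t x = t y → k x = k y → b x < b y → s y ≤ s x)
    (ha : SameMarginal (fun x => (a x, s x)) E' E)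
    (hb : SameMarginal (fun x => (b x, t x)) E' E)
    (hw : SameMarginal (fun x => (s x, t x, k x)) E' E) {κ N N' : ℕ}
    (hs : ∀ x, s x < N) (ht : ∀ x, t x < N')
    (hlow : ∀ c, mass E' (fun x => c ≤ a x ∧ k x < κ) = mass E (fun x => c ≤ a x ∧ k x < κ))
    (hlow' : ∀ c, mass E' (fun x => c ≤ b x ∧ k x < κ) = mass E (fun x => c ≤ b x ∧ k x < κ))
    {D : ℕ → ℕ → Prop} (hD : ∀ i i' l l', D i l → i' ≤ i → l' ≤ l → D i' l') (c d : ℕ)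
    (hrect : ∀ x, E x ≠ 0 → k x = κ → a x < c → b x < d → D (s x) (t x))
    (hquad : ∀ x, E x ≠ 0 → k x = κ → D (s x) (t x) → a x < c ∨ b x < d) :
    mass E (fun x => k x = κ ∧ a x < c ∧ b x < d) ≤
      mass E' (fun x => (k x = κ ∧ a x < c ∧ b x < d) ∧ D (s x) (t x)) := by
  have hA := mass_lowerSet_le hanti hlab ha hw hs hlow
    (fun i l l' h hl => hD i i l l' h le_rfl hl) c
  have hw' : SameMarginal (fun x => (t x, s x, k x)) E' E :=
    fun g => hw fun y => g (y.2.1, y.1, y.2.2)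
  have hB := mass_lowerSet_le (D := fun l i => D i l) hanti' hlab' hb hw' ht hlow'
    (fun l i i' h hi => hD i i' l l h hi le_rfl) d
  have hT : mass E' (fun x => k x = κ ∧ D (s x) (t x)) =
      mass E (fun x => k x = κ ∧ D (s x) (t x)) :=
    hw.mass_eq fun y => y.2.2 = κ ∧ D y.1 y.2.1
  -- Inclusion-exclusion over the two complementary half-planes: an equality for `E`, and an
  -- inequality for `E'`.
  have h1 (F : Ω → ℕ) := mass_split F (fun x => k x = κ ∧ D (s x) (t x)) (fun x => c ≤ a x)
  have h2 (F : Ω → ℕ) := mass_split F (fun x => (k x = κ ∧ D (s x) (t x)) ∧ ¬ c ≤ a x)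
    (fun x => d ≤ b x)
  have h3 : mass E' (fun x => ((k x = κ ∧ D (s x) (t x)) ∧ ¬ c ≤ a x) ∧ d ≤ b x) ≤
      mass E' (fun x => (k x = κ ∧ D (s x) (t x)) ∧ d ≤ b x) := mass_mono fun x _ h => ⟨h.1.1, h.2⟩
  have h4 : mass E (fun x => (k x = κ ∧ D (s x) (t x)) ∧ d ≤ b x) ≤
      mass E (fun x => ((k x = κ ∧ D (s x) (t x)) ∧ ¬ c ≤ a x) ∧ d ≤ b x) :=
    mass_mono fun x hx h => ⟨⟨h.1, by have := hquad x hx h.1.1 h.1.2; omega⟩, h.2⟩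
  have h5 : mass E (fun x => k x = κ ∧ a x < c ∧ b x < d) ≤
      mass E (fun x => ((k x = κ ∧ D (s x) (t x)) ∧ ¬ c ≤ a x) ∧ ¬ d ≤ b x) :=
    mass_mono fun x hx h =>
      ⟨⟨⟨h.1, hrect x hx h.1 h.2.1 h.2.2⟩, by omega⟩, by omega⟩
  have h6 : mass E' (fun x => ((k x = κ ∧ D (s x) (t x)) ∧ ¬ c ≤ a x) ∧ ¬ d ≤ b x) ≤
      mass E' (fun x => (k x = κ ∧ a x < c ∧ b x < d) ∧ D (s x) (t x)) :=
    mass_mono fun x _ h => ⟨⟨h.1.1.1, by omega, by omega⟩, h.1.1.2⟩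
  have := h1 E; have := h1 E'; have := h2 E; have := h2 E'
  omega

end Mass

/-! ### Chains and levels -/

section Levels
variable {σ : Type*}

/-- The relation whose chains are the diagonals of the minors of a flattening: the row index `α`
increases strictly, and so does the column index, the pair `(γ, β)` in lexicographic order. -/
def ChainRel (α β γ : σ → ℕ) (q p : σ) : Prop :=
  α q < α p ∧ (γ q < γ p ∨ γ q = γ p ∧ β q < β p)

theorem ChainRel.trans {α β γ : σ → ℕ} {q p o : σ} (h : ChainRel α β γ q p)
    (h' : ChainRel α β γ p o) : ChainRel α β γ q o := by
  unfold ChainRel at *; omega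

/-- `s` is the level function of the relation `r` on `P`: for `p ∈ P`, the number `s p` is the
largest number of steps of an `r`-chain in `P` ending at `p`. -/
structure IsLevel (r : σ → σ → Prop) (P : Finset σ) (s : σ → ℕ) : Prop where
  lt : ∀ q ∈ P, ∀ p ∈ P, r q p → s q < s p
  exists_pred : ∀ p ∈ P, 0 < s p → ∃ q ∈ P, r q p ∧ s q + 1 = s p

theorem exists_isLevel (α β γ : σ → ℕ) (P : Finset σ) : ∃ s, IsLevel (ChainRel α β γ) P s := by
  classical
  have wf : WellFounded (ChainRel α β γ) :=
    Subrelation.wf (fun h => h.1) (measure α).wf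
  let s : σ → ℕ := wf.fix fun p ih =>
    P.sup fun q => if h : ChainRel α β γ q p then ih q h + 1 else 0
  have hs (p : σ) : s p = P.sup fun q => if ChainRel α β γ q p then s q + 1 else 0 := by
    rw [show s p = _ from wf.fix_eq _ p]
    simp only [dite_eq_ite]
    rfl
  refine ⟨s, fun q hq p _ hqp => ?_, fun p _ hpos => ?_⟩
  · rw [hs p]
    have := Finset.le_sup (f := fun q => if ChainRel α β γ q p then s q + 1 else 0) hq
    simp only [hqp, if_true] at this
    omega
  · have hne : P.Nonempty := by
      rw [Finset.nonempty_iff_ne_empty]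
      rintro rfl
      rw [hs p] at hpos
      simp at hpos
    obtain ⟨q, hq, h⟩ := Finset.exists_mem_eq_sup P hne
      (fun q => if ChainRel α β γ q p then s q + 1 else 0)
    rw [← hs p] at h
    by_cases hqp : ChainRel α β γ q p
    · exact ⟨q, hq, hqp, by simp [hqp] at h; omega⟩
    · simp [hqp] at h; omega

theorem IsLevel.exists_chain {α β γ : σ → ℕ} {P : Finset σ} {s : σ → ℕ}
    (h : IsLevel (ChainRel α β γ) P s) (n : ℕ) : ∀ p ∈ P, s p = n →
      ∃ c : Fin (n + 1) → σ, (∀ i, c i ∈ P) ∧ c (Fin.last n) = p ∧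
        ∀ i i', i < i' → ChainRel α β γ (c i) (c i') := by
  induction n with
  | zero =>
    intro p hp _
    exact ⟨fun _ => p, fun _ => hp, rfl, fun i i' hi => by omega⟩
  | succ n ih =>
    intro p hp hsp
    obtain ⟨q, hq, hqp, hsq⟩ := h.exists_pred p hp (by omega)
    obtain ⟨c, hcP, hcl, hc⟩ := ih q hq (by omega)
    have hlast (i : Fin (n + 1)) : ChainRel α β γ (c i) p := by
      rcases (Fin.le_last i).eq_or_lt with rfl | hi
      · rwa [hcl]
      · exact (hc _ _ hi).trans (hcl ▸ hqp)
    refine ⟨Fin.snoc c p, fun i => ?_, Fin.snoc_last _ _, fun i i' hi => ?_⟩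
    · refine Fin.lastCases ?_ (fun i => ?_) i
      · simpa using hp
      · simpa using hcP i
    · revert hi
      refine Fin.lastCases ?_ (fun i' => ?_) i'
      · refine Fin.lastCases ?_ (fun i => ?_) i
        · intro h; exact absurd h (lt_irrefl _)
        · intro _; simpa using hlast i
      · refine Fin.lastCases ?_ (fun i => ?_) i
        · intro h; exact absurd h (not_lt.2 (Fin.le_last _))
        · intro h; simpa using hc i i' (by simpa using h)

theorem IsLevel.lt_of_no_chain {α β γ : σ → ℕ} {P : Finset σ} {s : σ → ℕ}
    (h : IsLevel (ChainRel α β γ) P s) {U : ℕ}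
    (hno : ¬ ∃ c : Fin (U + 1) → σ, (∀ i, c i ∈ P) ∧ ∀ i i', i < i' → ChainRel α β γ (c i) (c i'))
    {p : σ} (hp : p ∈ P) : s p < U := by
  by_contra hU
  obtain ⟨c, hcP, -, hc⟩ := h.exists_chain (s p) p hp rfl
  have hle : U + 1 ≤ s p + 1 := by omega
  exact hno ⟨fun i => c (Fin.castLE hle i), fun i => hcP _, fun i i' hi => hc _ _ (by simpa using hi)⟩

variable {α β γ : σ → ℕ} {P : Finset σ} {s t : σ → ℕ}

/-- Weakly to the north-west means a weakly smaller level. -/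
theorem IsLevel.le_of_le (hs : IsLevel (ChainRel α β γ) P s) {p q : σ} (hp : p ∈ P) (hq : q ∈ P)
    (hγ : γ p = γ q) (hα : α p ≤ α q) (hβ : β p ≤ β q) : s p ≤ s q := by
  rcases Nat.eq_zero_or_pos (s p) with h0 | h0
  · omega
  · obtain ⟨o, ho, hop, hso⟩ := hs.exists_pred p hp h0
    have := hs.lt o ho q hq (by unfold ChainRel at *; omega)
    omega

/-- The levels for the two flattenings are correlated: if, within a layer of `γ`, the point `p`
lies weakly to the north-east of `p'` and is not below it in level for the first flattening, then
neither is it for the second. The proof walks back simultaneously along an optimal chain of each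
kind; the two chains cannot cross. -/
theorem IsLevel.le_of_antitone (hs : IsLevel (ChainRel α β γ) P s)
    (ht : IsLevel (ChainRel β α γ) P t) (n : ℕ) : ∀ p ∈ P, ∀ p' ∈ P, t p' = n →
      γ p = γ p' → α p ≤ α p' → β p' ≤ β p → s p' ≤ s p → t p' ≤ t p := by
  induction n with
  | zero => intros; omega
  | succ n ih =>
    intro p hp p' hp' hn hγ hα hβ hsp
    -- `q` precedes `p'` in a chain for `t`, and `o` precedes `p` in a chain for `s`. Unless `t p' ≤ t p`
    -- follows at once, `o` lies to the north-east of `q`, and induction applies to this pair.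
    obtain ⟨q, hq, hqp', htq⟩ := ht.exists_pred p' hp' (by omega)
    by_cases hqp : ChainRel β α γ q p
    · have := ht.lt q hq p hp hqp
      omega
    have hq1 : γ q = γ p ∧ α p ≤ α q ∧ α q < α p' ∧ β q < β p' := by
      unfold ChainRel at *; omega
    have hsq := hs.lt q hq p' hp' (by unfold ChainRel at *; omega)
    obtain ⟨o, ho, hop, hso⟩ := hs.exists_pred p hp (by omega)
    have hoq : ¬ ChainRel α β γ o q := fun h => by
      have := hs.lt o ho q hq h
      omega
    have ho1 : γ o = γ q ∧ β q ≤ β o ∧ α o < α p ∧ β o < β p := by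
      unfold ChainRel at *; omega
    have h1 := ih o ho q hq (by omega) (by omega) (by omega) (by omega) (by omega)
    have h2 := ht.lt o ho p hp (by unfold ChainRel; omega)
    omega

variable [Fintype σ] {U V : ℕ} {E' E : σ × Fin U × Fin V → ℕ}

theorem mass_fst (E : σ × Fin U × Fin V → ℕ) (Q : σ → Prop) [DecidablePred Q] :
    mass E (fun x => Q x.1) = ∑ p, if Q p then ∑ l, E (p, l) else 0 := by
  classical
  rw [mass, Fintype.sum_prod_type]
  refine Finset.sum_congr rfl fun p _ => ?_
  by_cases h : Q p <;> simp [h]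

/-- `E` distributes a monomial with support `P` over the labels according to the levels, `E'`
distributes another monomial so that the contents agree. If the two monomials agree on the layers
before `κ`, then a rectangle at the bottom of the layer `κ` is at least as heavy for `E'`, even
after restricting to the labels dominated by those of the rectangle for `E`. -/
theorem mass_rectangle_le_of_isLevel (hs : IsLevel (ChainRel α β γ) P s)
    (ht : IsLevel (ChainRel β α γ) P t)
    (hEP : ∀ x, E x ≠ 0 → x.1 ∈ P) (hEs : ∀ x, E x ≠ 0 → (x.2.1 : ℕ) = s x.1)
    (hEt : ∀ x, E x ≠ 0 → (x.2.2 : ℕ) = t x.1)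
    (ha : SameMarginal (fun x => (α x.1, (x.2.1 : ℕ))) E' E)
    (hb : SameMarginal (fun x => (β x.1, (x.2.2 : ℕ))) E' E)
    (hw : SameMarginal (fun x => ((x.2.1 : ℕ), (x.2.2 : ℕ), γ x.1)) E' E) {κ : ℕ}
    (hlow : ∀ q, γ q < κ → ∑ l, E' (q, l) = ∑ l, E (q, l)) (c d : ℕ) :
    mass E (fun x => γ x.1 = κ ∧ α x.1 < c ∧ β x.1 < d) ≤
      mass E' (fun x => (γ x.1 = κ ∧ α x.1 < c ∧ β x.1 < d) ∧
        ∃ p ∈ P, γ p = κ ∧ α p < c ∧ β p < d ∧ (x.2.1 : ℕ) ≤ s p ∧ (x.2.2 : ℕ) ≤ t p) := by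
  classical
  have key (x y) (hx : E x ≠ 0) (hy : E y ≠ 0) :=
    And.intro (And.intro (hEP x hx) (hEP y hy))
      (And.intro (And.intro (hEs x hx) (hEs y hy)) (And.intro (hEt x hx) (hEt y hy)))
  have hanti : ∀ x y, E x ≠ 0 → E y ≠ 0 → (x.2.1 : ℕ) = y.2.1 → α x.1 < α y.1 →
      γ y.1 ≤ γ x.1 ∧ (γ x.1 = γ y.1 → β y.1 ≤ β x.1) := by
    intro x y hx hy hst hlt
    obtain ⟨⟨hxP, hyP⟩, ⟨hxs, hys⟩, -⟩ := key x y hx hy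
    have : ¬ ChainRel α β γ x.1 y.1 := fun h => by
      have := hs.lt _ hxP _ hyP h
      omega
    unfold ChainRel at this; omega
  have hanti' : ∀ x y, E x ≠ 0 → E y ≠ 0 → (x.2.2 : ℕ) = y.2.2 → β x.1 < β y.1 →
      γ y.1 ≤ γ x.1 ∧ (γ x.1 = γ y.1 → α y.1 ≤ α x.1) := by
    intro x y hx hy hst hlt
    obtain ⟨⟨hxP, hyP⟩, -, ⟨hxt, hyt⟩⟩ := key x y hx hy
    have : ¬ ChainRel β α γ x.1 y.1 := fun h => by
      have := ht.lt _ hxP _ hyP h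
      omega
    unfold ChainRel at this; omega
  refine mass_rectangle_le (a := fun x => α x.1) (b := fun x => β x.1) (k := fun x => γ x.1)
    (s := fun x => (x.2.1 : ℕ)) (t := fun x => (x.2.2 : ℕ)) (N := U) (N' := V)
    (D := fun i l => ∃ p ∈ P, γ p = κ ∧ α p < c ∧ β p < d ∧ i ≤ s p ∧ l ≤ t p)
    (fun x y hx hy h1 h2 => (hanti x y hx hy h1 h2).1) ?_
    (fun x y hx hy h1 h2 => (hanti' x y hx hy h1 h2).1) ?_ ha hb hw
    (fun x => x.2.1.2) (fun x => x.2.2.2) ?_ ?_ ?_ c d ?_ ?_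
  · intro x y hx hy h1 h2 h3
    have h4 := (hanti x y hx hy h1 h3).2 h2
    obtain ⟨⟨hxP, hyP⟩, ⟨hxs, hys⟩, ⟨hxt, hyt⟩⟩ := key x y hx hy
    have := hs.le_of_antitone ht _ x.1 hxP y.1 hyP rfl h2 h3.le h4 (by omega)
    omega
  · intro x y hx hy h1 h2 h3
    have h4 := (hanti' x y hx hy h1 h3).2 h2
    obtain ⟨⟨hxP, hyP⟩, ⟨hxs, hys⟩, ⟨hxt, hyt⟩⟩ := key x y hx hy
    have := ht.le_of_antitone hs _ x.1 hxP y.1 hyP rfl h2 h3.le h4 (by omega)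
    omega
  · intro c
    rw [mass_fst E' (fun q => c ≤ α q ∧ γ q < κ), mass_fst E (fun q => c ≤ α q ∧ γ q < κ)]
    refine Finset.sum_congr rfl fun q _ => ?_
    split_ifs with h
    exacts [hlow q h.2, rfl]
  · intro c
    rw [mass_fst E' (fun q => c ≤ β q ∧ γ q < κ), mass_fst E (fun q => c ≤ β q ∧ γ q < κ)]
    refine Finset.sum_congr rfl fun q _ => ?_
    split_ifs with h
    exacts [hlow q h.2, rfl]
  · rintro i i' l l' ⟨p, hp, h1, h2, h3, h4, h5⟩ hi hl
    exact ⟨p, hp, h1, h2, h3, hi.trans h4, hl.trans h5⟩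
  · intro x hx h1 h2 h3
    exact ⟨x.1, hEP x hx, h1, h2, h3, (hEs x hx).le, (hEt x hx).le⟩
  · rintro x hx h1 ⟨p, hp, h2, h3, h4, h5, h6⟩
    by_contra hcd
    have := hs.lt p hp x.1 (hEP x hx) (by unfold ChainRel; omega)
    have := hEs x hx
    omega

/-- The lexicographic comparison of two indices, first by `γ`, then by `α`, then by `β`. -/
def KeyLT (α β γ : σ → ℕ) (q p : σ) : Prop :=
  γ q < γ p ∨ γ q = γ p ∧ (α q < α p ∨ α q = α p ∧ β q < β p)

/-- Labelling a monomial by its levels minimizes it among all labelled monomials of the same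
content, and the minimum is attained only once. -/
theorem eq_of_sameMarginal_of_isLevel (hinj : ∀ p q, γ p = γ q → α p = α q → β p = β q → p = q)
    (hs : IsLevel (ChainRel α β γ) P s) (ht : IsLevel (ChainRel β α γ) P t)
    (hP : ∀ p, p ∈ P ↔ ∑ l, E (p, l) ≠ 0)
    (hEs : ∀ x, E x ≠ 0 → (x.2.1 : ℕ) = s x.1) (hEt : ∀ x, E x ≠ 0 → (x.2.2 : ℕ) = t x.1)
    (ha : SameMarginal (fun x => (α x.1, (x.2.1 : ℕ))) E' E)
    (hb : SameMarginal (fun x => (β x.1, (x.2.2 : ℕ))) E' E)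
    (hw : SameMarginal (fun x => ((x.2.1 : ℕ), (x.2.2 : ℕ), γ x.1)) E' E)
    (hle : (∀ p, ∑ l, E' (p, l) = ∑ l, E (p, l)) ∨
      ∃ p, (∀ q, KeyLT α β γ q p → ∑ l, E' (q, l) = ∑ l, E (q, l)) ∧
        ∑ l, E' (p, l) < ∑ l, E (p, l)) : E' = E := by
  classical
  have hEP (x) (hx : E x ≠ 0) : x.1 ∈ P := by
    exact (hP _).2 fun h => hx (Finset.sum_eq_zero_iff.1 h x.2 (Finset.mem_univ _))
  have main {κ : ℕ} := mass_rectangle_le_of_isLevel (κ := κ) hs ht hEP hEs hEt ha hb hw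
  have hM : ∀ p, ∑ l, E' (p, l) = ∑ l, E (p, l) := by
    refine hle.resolve_right ?_
    rintro ⟨p, hlt, hp⟩
    -- In the rectangle with corner `p`, all points but `p` come before `p`.
    have h1 := main (κ := γ p) (fun q hq => hlt q (Or.inl hq)) (α p + 1) (β p + 1)
    have h2 := h1.trans (mass_mono fun x _ h => h.1)
    rw [mass_fst E (fun q => γ q = γ p ∧ α q < α p + 1 ∧ β q < β p + 1),
      mass_fst E' (fun q => γ q = γ p ∧ α q < α p + 1 ∧ β q < β p + 1)] at h2
    refine absurd h2 (not_le.2 (Finset.sum_lt_sum (fun q _ => ?_) ⟨p, Finset.mem_univ _, ?_⟩))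
    · split_ifs with hq
      · by_cases hqp : q = p
        · rw [hqp]; exact hp.le
        · refine (hlt q ?_).le
          have : ¬ (α q = α p ∧ β q = β p) := fun h => hqp (hinj q p hq.1 h.1 h.2)
          unfold KeyLT; omega
      · exact le_rfl
    · simpa using hp
  -- The labels of `E'` are dominated by the levels ...
  have hlab (x) (hx : E' x ≠ 0) : (x.2.1 : ℕ) ≤ s x.1 ∧ (x.2.2 : ℕ) ≤ t x.1 := by
    have hxP : x.1 ∈ P := by
      rw [hP, ← hM]
      exact fun h => hx (Finset.sum_eq_zero_iff.1 h x.2 (Finset.mem_univ _))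
    have h1 := main (κ := γ x.1) (fun q _ => hM q) (α x.1 + 1) (β x.1 + 1)
    have h2 : mass E (fun y => γ y.1 = γ x.1 ∧ α y.1 < α x.1 + 1 ∧ β y.1 < β x.1 + 1) =
        mass E' (fun y => γ y.1 = γ x.1 ∧ α y.1 < α x.1 + 1 ∧ β y.1 < β x.1 + 1) := by
      rw [mass_fst E (fun q => γ q = γ x.1 ∧ α q < α x.1 + 1 ∧ β q < β x.1 + 1),
        mass_fst E' (fun q => γ q = γ x.1 ∧ α q < α x.1 + 1 ∧ β q < β x.1 + 1)]
      simp only [hM]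
    rw [h2, mass_split E' (fun y => γ y.1 = γ x.1 ∧ α y.1 < α x.1 + 1 ∧ β y.1 < β x.1 + 1)
      (fun y => ∃ p ∈ P, γ p = γ x.1 ∧ α p < α x.1 + 1 ∧ β p < β x.1 + 1 ∧
        (y.2.1 : ℕ) ≤ s p ∧ (y.2.2 : ℕ) ≤ t p)] at h1
    have h3 : ∃ p ∈ P, γ p = γ x.1 ∧ α p < α x.1 + 1 ∧ β p < β x.1 + 1 ∧
        (x.2.1 : ℕ) ≤ s p ∧ (x.2.2 : ℕ) ≤ t p := by
      by_contra hno
      refine hx (eq_zero_of_mass_eq_zero (Nat.eq_zero_of_le_zero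
        (Nat.le_of_add_le_add_left (h1.trans (Nat.add_zero _).ge))) ⟨⟨rfl, ?_, ?_⟩, hno⟩)
      exacts [Nat.lt_succ_self _, Nat.lt_succ_self _]
    obtain ⟨p, hp, hγ, hα, hβ, hps, hpt⟩ := h3
    exact ⟨hps.trans (hs.le_of_le hp hxP hγ (by omega) (by omega)),
      hpt.trans (ht.le_of_le hp hxP hγ (by omega) (by omega))⟩
  -- ... and have the same sums as the levels, hence equal them.
  have hfst (f : σ → ℕ) : ∑ x, E' x * f x.1 = ∑ x, E x * f x.1 := by
    simp only [Fintype.sum_prod_type (f := fun x : σ × Fin U × Fin V => _ * f x.1), ← Finset.sum_mul,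
      hM]
  have hsE' : ∀ x, E' x ≠ 0 → (x.2.1 : ℕ) = s x.1 := by
    have h1 := ha fun y => y.2
    have h2 : ∑ x, E x * (x.2.1 : ℕ) = ∑ x, E x * s x.1 :=
      Finset.sum_congr rfl fun x _ => by
        by_cases hx : E x = 0
        · simp [hx]
        · rw [hEs x hx]
    have h3 := (h1.trans h2).trans (hfst s).symm
    intro x hx
    have h4 := (Finset.sum_eq_sum_iff_of_le fun x _ => by
      by_cases hx : E' x = 0
      · simp [hx]
      · exact Nat.mul_le_mul_left _ (hlab x hx).1).1 h3 x (Finset.mem_univ _)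
    exact Nat.eq_of_mul_eq_mul_left (Nat.pos_of_ne_zero hx) h4
  have htE' : ∀ x, E' x ≠ 0 → (x.2.2 : ℕ) = t x.1 := by
    have h1 := hb fun y => y.2
    have h2 : ∑ x, E x * (x.2.2 : ℕ) = ∑ x, E x * t x.1 :=
      Finset.sum_congr rfl fun x _ => by
        by_cases hx : E x = 0
        · simp [hx]
        · rw [hEt x hx]
    have h3 := (h1.trans h2).trans (hfst t).symm
    intro x hx
    have h4 := (Finset.sum_eq_sum_iff_of_le fun x _ => by
      by_cases hx : E' x = 0
      · simp [hx]
      · exact Nat.mul_le_mul_left _ (hlab x hx).2).1 h3 x (Finset.mem_univ _)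
    exact Nat.eq_of_mul_eq_mul_left (Nat.pos_of_ne_zero hx) h4
  have eval (F : σ × Fin U × Fin V → ℕ) (hF : ∀ x, F x ≠ 0 → (x.2.1 : ℕ) = s x.1)
      (hF' : ∀ x, F x ≠ 0 → (x.2.2 : ℕ) = t x.1) (x : σ × Fin U × Fin V)
      (hx : (x.2.1 : ℕ) = s x.1 ∧ (x.2.2 : ℕ) = t x.1) : F x = ∑ l, F (x.1, l) := by
    refine (Fintype.sum_eq_single (f := fun l => F (x.1, l)) x.2 fun l hl => ?_).symm
    by_contra hne
    have := hF (x.1, l) hne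
    have := hF' (x.1, l) hne
    exact hl (Prod.ext (Fin.ext (by simp_all)) (Fin.ext (by simp_all)))
  funext x
  by_cases hx : (x.2.1 : ℕ) = s x.1 ∧ (x.2.2 : ℕ) = t x.1
  · rw [eval E' hsE' htE' x hx, eval E hEs hEt x hx, hM]
  · have h1 : E' x = 0 := by_contra fun h => hx ⟨hsE' x h, htE' x h⟩
    have h2 : E x = 0 := by_contra fun h => hx ⟨hEs x h, hEt x h⟩
    rw [h1, h2]

end Levels

/-! ### Expanding a monomial into labelled monomials -/

section Spread
variable {σ Λ K : Type*} [Fintype Λ] [CommRing K]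

/-- The substitution `x_p ↦ ∑ l, x_{(p, l)}`, which expands a monomial into its labelled
versions. -/
noncomputable def spread (σ Λ K : Type*) [Fintype Λ] [CommRing K] :
    MvPolynomial σ K →ₐ[K] MvPolynomial (σ × Λ) K :=
  aeval fun p => ∑ l, X (p, l)

theorem spread_monomial_add (e : σ →₀ ℕ) (p : σ) (c : K) :
    spread σ Λ K (monomial (e + Finsupp.single p 1) c) =
      ∑ l, spread σ Λ K (monomial e c) * X (p, l) := by
  rw [← Finset.mul_sum, monomial_add_single, map_mul, pow_one]
  simp [spread]

/-- Every labelled monomial in the expansion of a monomial gives it back when the labels are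
forgotten. -/
theorem mapDomain_fst_of_coeff_spread_ne_zero (n : ℕ) : ∀ (e : σ →₀ ℕ) (c : K) (E : σ × Λ →₀ ℕ),
    e.degree = n → coeff E (spread σ Λ K (monomial e c)) ≠ 0 → E.mapDomain Prod.fst = e := by
  classical
  induction n with
  | zero =>
    intro e c E he hE
    obtain rfl := (Finsupp.degree_eq_zero_iff e).1 he
    have h0 : E = 0 := by
      by_contra hne
      refine hE ?_
      rw [← C_apply, ← algebraMap_eq, AlgHom.commutes, algebraMap_eq, coeff_C, if_neg (Ne.symm hne)]
    rw [h0, Finsupp.mapDomain_zero]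
  | succ n ih =>
    intro e c E he hE
    obtain ⟨p, hp⟩ : ∃ p, e p ≠ 0 := by
      by_contra! h
      obtain rfl : e = 0 := Finsupp.ext h
      simp at he
    obtain ⟨e₁, rfl⟩ := exists_add_of_le
      (show Finsupp.single p 1 ≤ e by rw [Finsupp.single_le_iff]; omega)
    rw [add_comm] at *
    rw [spread_monomial_add, coeff_sum] at hE
    obtain ⟨l, -, hl⟩ := Finset.exists_ne_zero_of_sum_ne_zero hE
    rw [coeff_mul_X'] at hl
    split_ifs at hl with hmem
    · have h1 := ih e₁ c _ (by simpa using he) hl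
      have h2 : Finsupp.single (p, l) 1 ≤ E := by
        rw [Finsupp.single_le_iff]; exact Nat.one_le_iff_ne_zero.2 (Finsupp.mem_support_iff.1 hmem)
      rw [← tsub_add_cancel_of_le h2, Finsupp.mapDomain_add, h1, Finsupp.mapDomain_single]
    · exact absurd rfl hl

/-- Only one monomial of `f` contributes to a given labelled monomial. -/
theorem coeff_spread (f : MvPolynomial σ K) (E : σ × Λ →₀ ℕ) :
    coeff E (spread σ Λ K f) = coeff E (spread σ Λ K
      (monomial (E.mapDomain Prod.fst) (coeff (E.mapDomain Prod.fst) f))) := by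
  classical
  conv_lhs => rw [f.as_sum, map_sum, coeff_sum]
  by_cases h : E.mapDomain Prod.fst ∈ f.support
  · refine Finset.sum_eq_single_of_mem _ h fun e _ he => ?_
    by_contra hne
    exact he (mapDomain_fst_of_coeff_spread_ne_zero _ e _ E rfl hne).symm
  · rw [notMem_support_iff.1 h, monomial_zero, map_zero, coeff_zero]
    refine Finset.sum_eq_zero fun e he => ?_
    by_contra hne
    exact h (mapDomain_fst_of_coeff_spread_ne_zero _ e _ E rfl hne ▸ he)

/-- If `E` gives only one label to each variable, then it occurs with coefficient `1` in the
expansion of the monomial that it labels. -/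
theorem coeff_spread_monomial (n : ℕ) : ∀ (E : σ × Λ →₀ ℕ) (c : K), E.degree = n →
    (∀ p l l', E (p, l) ≠ 0 → E (p, l') ≠ 0 → l = l') →
      coeff E (spread σ Λ K (monomial (E.mapDomain Prod.fst) c)) = c := by
  classical
  induction n with
  | zero =>
    intro E c hE _
    obtain rfl := (Finsupp.degree_eq_zero_iff E).1 hE
    simp [spread]
  | succ n ih =>
    intro E c hE huniq
    obtain ⟨⟨p, l⟩, hpl⟩ : ∃ x, E x ≠ 0 := by
      by_contra! h
      obtain rfl : E = 0 := Finsupp.ext h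
      simp at hE
    have hle : Finsupp.single (p, l) 1 ≤ E := by
      rw [Finsupp.single_le_iff]; omega
    obtain ⟨E₁, rfl⟩ := exists_add_of_le hle
    rw [add_comm] at *
    rw [Finsupp.mapDomain_add, Finsupp.mapDomain_single, spread_monomial_add, coeff_sum,
      Finset.sum_eq_single l]
    · rw [coeff_mul_X]
      refine ih E₁ c (by simpa using hE) fun q i i' hi hi' => huniq q i i' ?_ ?_ <;>
        simp only [Finsupp.add_apply] <;> omega
    · intro i _ hi
      rw [coeff_mul_X', if_neg]
      intro hmem
      exact hi (huniq p i l (Finsupp.mem_support_iff.1 hmem) hpl)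
    · simp
end Spread

/-! ### Determinants of products through a smaller dimension -/

section Det
theorem det_mul_eq_zero_of_lt {R : Type*} [CommRing R] {n U : ℕ} (h : U < n)
    (A : Matrix (Fin n) (Fin U) R) (B : Matrix (Fin U) (Fin n) R) : (A * B).det = 0 := by
  classical
  obtain ⟨d, rfl⟩ := Nat.exists_eq_add_of_lt h
  -- Pad both factors with zeros to square matrices.
  let A' : Matrix (Fin (U + (d + 1))) (Fin (U + (d + 1))) R :=
    fun i => Fin.append (A i) fun _ => 0
  let B' : Matrix (Fin (U + (d + 1))) (Fin (U + (d + 1))) R :=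
    fun k j => Fin.append (fun k => B k j) (fun _ => 0) k
  have hAB : A * B = A' * B' := by
    ext i j
    rw [Matrix.mul_apply, Matrix.mul_apply]
    refine Eq.trans ?_ (Fin.sum_univ_add (fun k => A' i k * B' k j)).symm
    simp [A', B']
  rw [hAB, Matrix.det_mul, Matrix.det_eq_zero_of_column_eq_zero (Fin.natAdd U (Fin.last d)),
    zero_mul]
  exact fun i => Fin.append_right (A i) _ (Fin.last d)
end Det

/-! ### The kernel of the Tucker parametrization -/

section Tucker
open scoped MonomialOrder
variable {σ : Type*} (α β γ : σ → ℕ) (U V : ℕ) (K : Type*)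

/-- The variables of the Tucker parametrization: the entries of the two factor matrices and of the
core tensor. -/
abbrev TuckerVar : Type := (ℕ × ℕ) ⊕ (ℕ × ℕ) ⊕ (ℕ × ℕ × ℕ)

/-- The exponent of the monomial `y_{α p, i} z_{β p, l} w_{i, l, γ p}`. -/
noncomputable def tuckerExponent (x : σ × Fin U × Fin V) : TuckerVar →₀ ℕ :=
  Finsupp.single (Sum.inl (α x.1, (x.2.1 : ℕ))) 1 +
    Finsupp.single (Sum.inr (Sum.inl (β x.1, (x.2.2 : ℕ)))) 1 +
    Finsupp.single (Sum.inr (Sum.inr ((x.2.1 : ℕ), (x.2.2 : ℕ), γ x.1))) 1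

/-- The Tucker parametrization `x_p ↦ ∑ i < U, ∑ l < V, y_{α p, i} z_{β p, l} w_{i, l, γ p}` of the
tensors whose flattenings along `α` and `β` have ranks at most `U` and `V`. -/
noncomputable def tucker [CommRing K] : MvPolynomial σ K →ₐ[K] MvPolynomial TuckerVar K :=
  (aeval fun x => monomial (tuckerExponent α β γ U V x) 1).comp (spread σ (Fin U × Fin V) K)

variable {α β γ U V K}

theorem tucker_X [CommRing K] (p : σ) : tucker α β γ U V K (X p) =
    ∑ i : Fin U, ∑ l : Fin V, X (Sum.inl (α p, (i : ℕ))) * X (Sum.inr (Sum.inl (β p, (l : ℕ)))) *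
      X (Sum.inr (Sum.inr ((i : ℕ), (l : ℕ), γ p))) := by
  simp only [tucker, spread, AlgHom.comp_apply, aeval_X, map_sum, Fintype.sum_prod_type]
  simp only [tuckerExponent, X, monomial_mul, one_mul]

theorem aeval_monomial_monomial [CommRing K] {Ω τ : Type*} [Fintype Ω] (φ : Ω → τ →₀ ℕ)
    (E : Ω →₀ ℕ) (c : K) :
    aeval (fun x => monomial (φ x) (1 : K)) (monomial E c) = monomial (∑ x, E x • φ x) c := by
  rw [aeval_monomial, Finsupp.prod_fintype _ _ (by simp)]
  simp only [monomial_pow, one_pow, ← monomial_sum_one, algebraMap_eq, C_mul_monomial, mul_one]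

/-- The exponent of the image of a labelled monomial records its content. -/
theorem sameMarginal_of_content_eq [Fintype σ] {E' E : σ × Fin U × Fin V → ℕ}
    (h : ∑ x, E' x • tuckerExponent α β γ U V x = ∑ x, E x • tuckerExponent α β γ U V x) :
    SameMarginal (fun x => (α x.1, (x.2.1 : ℕ))) E' E ∧
      SameMarginal (fun x => (β x.1, (x.2.2 : ℕ))) E' E ∧
      SameMarginal (fun x => ((x.2.1 : ℕ), (x.2.2 : ℕ), γ x.1)) E' E := by
  have key (g : TuckerVar → ℕ) := congrArg (Finsupp.linearCombination ℕ g) h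
  simp only [map_sum, map_smul, tuckerExponent, map_add, Finsupp.linearCombination_single,
    smul_eq_mul, one_mul] at key
  refine ⟨fun g => ?_, fun g => ?_, fun g => ?_⟩
  · simpa using key (Sum.elim g 0)
  · simpa using key (Sum.elim 0 (Sum.elim g 0))
  · simpa using key (Sum.elim 0 (Sum.elim 0 g))

theorem mapDomain_fst_apply {Λ : Type*} [Fintype σ] [Fintype Λ] (E : σ × Λ →₀ ℕ) (p : σ) :
    E.mapDomain Prod.fst p = ∑ l, E (p, l) := by
  classical
  rw [Finsupp.mapDomain, Finsupp.sum_fintype _ _ (by simp), Finsupp.finsetSum_apply,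
    Fintype.sum_prod_type, Finset.sum_eq_single p]
  · simp
  · intro q _ hq
    simp [hq]
  · simp

/-- A nonzero polynomial vanishing on all tensors of multilinear rank at most `(U, V)` has a leading
monomial divisible by the diagonal of a minor of size `U + 1` of the first flattening, or of size
`V + 1` of the second. -/
theorem exists_chain_of_tucker_eq_zero [Finite σ] [Field K] (m : MonomialOrder σ)
    (hm : ∀ d e, d ≺[m] e ↔ ∃ p, (∀ q, KeyLT α β γ q p → d q = e q) ∧ d p < e p)
    (hinj : ∀ p q, γ p = γ q → α p = α q → β p = β q → p = q)
    {f : MvPolynomial σ K} (hf : f ≠ 0) (h0 : tucker α β γ U V K f = 0) :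
    (∃ c : Fin (U + 1) → σ, (∀ i, c i ∈ (m.degree f).support) ∧
      ∀ i i', i < i' → ChainRel α β γ (c i) (c i')) ∨
    ∃ c : Fin (V + 1) → σ, (∀ i, c i ∈ (m.degree f).support) ∧
      ∀ i i', i < i' → ChainRel β α γ (c i) (c i') := by
  classical
  have := Fintype.ofFinite σ
  by_contra hno
  rw [not_or] at hno
  set M := m.degree f with hM
  obtain ⟨s, hs⟩ := exists_isLevel α β γ M.support
  obtain ⟨t, ht⟩ := exists_isLevel β α γ M.support
  -- `E` is the monomial `M` with each variable labelled by its levels.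
  let E : σ × Fin U × Fin V →₀ ℕ := Finsupp.equivFunOnFinite.symm fun x =>
    if (x.2.1 : ℕ) = s x.1 ∧ (x.2.2 : ℕ) = t x.1 then M x.1 else 0
  have hE (x) : E x = if (x.2.1 : ℕ) = s x.1 ∧ (x.2.2 : ℕ) = t x.1 then M x.1 else 0 := rfl
  have hlab (x) (hx : E x ≠ 0) : (x.2.1 : ℕ) = s x.1 ∧ (x.2.2 : ℕ) = t x.1 := by
    by_contra h
    exact hx (by rw [hE, if_neg h])
  have hmarg (p : σ) : ∑ l, E (p, l) = M p := by
    by_cases hp : p ∈ M.support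
    · rw [Finset.sum_eq_single (⟨s p, hs.lt_of_no_chain hno.1 hp⟩, ⟨t p, ht.lt_of_no_chain hno.2 hp⟩)]
      · simp [hE]
      · intro l _ hl
        by_contra hne
        have := hlab _ hne
        exact hl (Prod.ext (Fin.ext this.1) (Fin.ext this.2))
      · simp
    · have : M p = 0 := by simpa using hp
      simp [hE, this]
  have hmargE : E.mapDomain Prod.fst = M := Finsupp.ext fun p => by rw [mapDomain_fst_apply, hmarg]
  have hcoeff : coeff E (spread σ (Fin U × Fin V) K f) = m.leadingCoeff f := by
    rw [coeff_spread, coeff_spread_monomial _ E _ rfl, hmargE]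
    · rfl
    · intro p l l' h h'
      have := hlab _ h
      have := hlab _ h'
      exact Prod.ext (Fin.ext (by simp_all)) (Fin.ext (by simp_all))
  have hlc : m.leadingCoeff f ≠ 0 := m.leadingCoeff_ne_zero_iff.2 hf
  refine hlc ?_
  have hc := congrArg (coeff (∑ x, E x • tuckerExponent α β γ U V x)) h0
  rw [coeff_zero, tucker, AlgHom.comp_apply, (spread σ (Fin U × Fin V) K f).as_sum, map_sum,
    coeff_sum] at hc
  rw [Finset.sum_eq_single E] at hc
  · rwa [aeval_monomial_monomial, coeff_monomial, if_pos rfl, hcoeff] at hc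
  · intro E' hE' hne
    rw [aeval_monomial_monomial, coeff_monomial, if_neg]
    intro hcont
    obtain ⟨ha, hb, hw⟩ := sameMarginal_of_content_eq hcont
    refine hne (DFunLike.coe_injective
      (eq_of_sameMarginal_of_isLevel (P := M.support) hinj hs ht (fun p => ?_)
        (fun x hx => (hlab x hx).1) (fun x hx => (hlab x hx).2) ha hb hw ?_))
    · rw [hmarg, Finsupp.mem_support_iff]
    · have hsupp : E'.mapDomain Prod.fst ∈ f.support := by
        rw [mem_support_iff] at hE' ⊢
        intro h
        rw [coeff_spread, h, monomial_zero, map_zero, coeff_zero] at hE'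
        exact hE' rfl
      simp only [← mapDomain_fst_apply, hmargE]
      rcases (m.le_degree hsupp).eq_or_lt with h | h
      · exact Or.inl fun p => by rw [m.toSyn.injective h]
      · exact Or.inr ((hm _ _).1 h)
  · intro h
    rw [notMem_support_iff] at h
    exact absurd (hcoeff.symm.trans h) hlc

end Tucker

/-! ### Leading terms and a criterion for Gröbner bases -/

section LeadingTerms
open scoped MonomialOrder
variable {σ K : Type*} [Field K]

/-- If the variables in a square matrix decrease along rows and columns (they increase with respect
to the relation `L` on indices, for which small indices give large variables), then the leading
term of the determinant for the lexicographic order is the diagonal. -/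
theorem leadingTerm_det {L : σ → σ → Prop} (htrans : ∀ p q r, L p q → L q r → L p r)
    (hirr : ∀ p, ¬ L p p) (m : MonomialOrder σ)
    (hm : ∀ d e, d ≺[m] e ↔ ∃ p, (∀ q, L q p → d q = e q) ∧ d p < e p) {u : ℕ}
    (π : Fin u → Fin u → σ) (hrow : ∀ i i' j, i < i' → L (π i j) (π i' j))
    (hcol : ∀ i j j', j < j' → L (π i j) (π i j')) :
    m.leadingTerm (Matrix.of fun i j => (X (π i j) : MvPolynomial σ K)).det =
      monomial (∑ i, Finsupp.single (π i i) 1) 1 := by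
  classical
  let e (τ : Equiv.Perm (Fin u)) : σ →₀ ℕ := ∑ i, Finsupp.single (π (τ i) i) 1
  have he (τ) (q : σ) : e τ q = ∑ i, if π (τ i) i = q then 1 else 0 := by
    simp [e, Finsupp.finsetSum_apply, Finsupp.single_apply]
  have hlt (τ : Equiv.Perm (Fin u)) (hτ : τ ≠ 1) : e τ ≺[m] e 1 := by
    -- The comparison is decided at the first diagonal entry that `τ` misses.
    obtain ⟨i, hi, hmin⟩ : ∃ i, τ i ≠ i ∧ ∀ j < i, τ j = j := by
      have hne : ∃ i, τ i ≠ i := by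
        by_contra! h
        exact hτ (Equiv.ext h)
      obtain ⟨i, hi, hmin⟩ := WellFounded.has_min (wellFounded_lt (α := Fin u)) {i | τ i ≠ i} hne
      exact ⟨i, hi, fun j hj => by_contra fun h => hmin j h hj⟩
    have hge (j) (hj : i ≤ j) : i ≤ τ j := by
      by_contra! h
      have := τ.injective (hmin _ h)
      omega
    have hle (i' j') (hi' : i ≤ i') (hj' : i ≤ j') (hne : ¬ (i' = i ∧ j' = i)) :
        L (π i i) (π i' j') := by
      rcases hi'.eq_or_lt with rfl | h1
      · exact hcol _ _ _ (lt_of_le_of_ne hj' fun h => hne ⟨rfl, h.symm⟩)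
      · rcases hj'.eq_or_lt with rfl | h2
        · exact hrow _ _ _ h1
        · exact htrans _ _ _ (hrow _ _ _ h1) (hcol _ _ _ h2)
    have hτ (j) (hj : i ≤ j) : L (π i i) (π (τ j) j) :=
      hle _ _ (hge j hj) hj fun h => hi (by rw [← h.2, h.1, h.2])
    have hne (q) (hq : q = π i i ∨ L q (π i i)) (j) (hj : i ≤ j) : π (τ j) j ≠ q := by
      rintro rfl
      rcases hq with h | h
      · exact hirr _ (h ▸ hτ j hj)
      · exact hirr _ (htrans _ _ _ (hτ j hj) h)
    refine (hm _ _).2 ⟨π i i, fun q hq => ?_, ?_⟩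
    · rw [he, he]
      refine Finset.sum_congr rfl fun j _ => ?_
      by_cases hj : i ≤ j
      · rw [if_neg (hne q (Or.inr hq) j hj), if_neg]
        rintro rfl
        by_cases hij : j = i
        · exact hirr _ (hij ▸ hq)
        · exact hirr _ (htrans _ _ _ (hle j j hj hj fun h => hij h.1) hq)
      · rw [hmin j (not_le.1 hj), Equiv.Perm.one_apply]
    · rw [he, he]
      refine Finset.sum_lt_sum (fun j _ => ?_) ⟨i, Finset.mem_univ _, ?_⟩
      · by_cases hj : i ≤ j
        · rw [if_neg (hne _ (Or.inl rfl) j hj)]; exact Nat.zero_le _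
        · rw [hmin j (not_le.1 hj), Equiv.Perm.one_apply]
      · rw [if_neg (hne _ (Or.inl rfl) i le_rfl)]; simp
  have hdet : (Matrix.of fun i j => (X (π i j) : MvPolynomial σ K)).det =
      ∑ τ : Equiv.Perm (Fin u), monomial (e τ) ((Equiv.Perm.sign τ : ℤ) : K) := by
    rw [Matrix.det_apply']
    refine Finset.sum_congr rfl fun τ _ => ?_
    rw [← mul_one ((Equiv.Perm.sign τ : ℤ) : K), ← C_mul_monomial, map_intCast, monomial_sum_one]
    rfl
  set f := (Matrix.of fun i j => (X (π i j) : MvPolynomial σ K)).det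
  have hcoeff : coeff (e 1) f = 1 := by
    rw [hdet, coeff_sum, Finset.sum_eq_single 1]
    · simp
    · intro τ _ hτ
      have : e τ ≠ e 1 := fun h => (hlt τ hτ).ne (congrArg _ h)
      rw [coeff_monomial, if_neg this]
    · simp
  have hdeg : m.degree f = e 1 := by
    refine m.toSyn.injective (le_antisymm (m.degree_le_iff.2 fun d hd => ?_)
      (m.le_degree (by simp [hcoeff])))
    by_contra hlt'
    refine mem_support_iff.1 hd ?_
    rw [hdet, coeff_sum]
    refine Finset.sum_eq_zero fun τ _ => ?_
    have : e τ ≠ d := by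
      rintro rfl
      by_cases hτ : τ = 1
      · exact hlt' (hτ ▸ le_rfl)
      · exact hlt' (hlt τ hτ).le
    rw [coeff_monomial, if_neg this]
  rw [MonomialOrder.leadingTerm, MonomialOrder.leadingCoeff, hdeg, hcoeff]
  rfl

theorem sum_single_le {u : ℕ} {c : Fin u → σ} (hc : Function.Injective c) {M : σ →₀ ℕ}
    (hM : ∀ i, c i ∈ M.support) : ∑ i, Finsupp.single (c i) 1 ≤ M := by
  classical
  intro q
  rw [Finsupp.finsetSum_apply]
  by_cases h : ∃ i, c i = q
  · obtain ⟨i, rfl⟩ := h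
    rw [Finset.sum_eq_single i (fun i' _ hi' => by simp [hc.ne hi'.symm]) (by simp)]
    have := Finsupp.mem_support_iff.1 (hM i)
    simp only [Finsupp.single_eq_same]
    omega
  · push Not at h
    rw [Finset.sum_eq_zero fun i _ => by simp [(h i).symm]]
    exact Nat.zero_le _

/-- A criterion for Gröbner bases: `G` is killed by a ring homomorphism, and each leading monomial
of the kernel is divisible by the leading monomial of an element of `G` with leading coefficient
one. -/
theorem isGroebnerBasis_of_forall_ker {R : Type*} [CommRing R] (m : MonomialOrder σ)
    {G : Set (MvPolynomial σ K)} (hfin : G.Finite) (ψ : MvPolynomial σ K →+* R)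
    (hG : ∀ g ∈ G, ψ g = 0)
    (h : ∀ f, f ≠ 0 → ψ f = 0 →
      ∃ g ∈ G, ∃ d ≤ m.degree f, m.leadingTerm g = monomial d 1) : IsGroebnerBasis m G := by
  refine ⟨hfin, le_antisymm (Ideal.span_mono (Set.image_mono Ideal.subset_span))
    (Ideal.span_le.2 ?_)⟩
  rintro _ ⟨f, hf, rfl⟩
  by_cases hf0 : f = 0
  · simp [hf0, MonomialOrder.leadingTerm]
  have hker : ψ f = 0 := (Ideal.span_le.2 fun g hg => RingHom.mem_ker.2 (hG g hg) :
    Ideal.span G ≤ RingHom.ker ψ) hf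
  obtain ⟨g, hg, d, hd, hlt⟩ := h f hf0 hker
  have : m.leadingTerm f = monomial (m.degree f - d) (m.leadingCoeff f) * m.leadingTerm g := by
    rw [hlt, monomial_mul, mul_one, tsub_add_cancel_of_le hd, MonomialOrder.leadingTerm]
  rw [this]
  exact Ideal.mul_mem_left _ _ (Ideal.subset_span ⟨g, hg, rfl⟩)

end LeadingTerms

/-! ### The monomial order -/

section Key
open scoped MonomialOrder
variable {σ : Type} {α β γ : σ → ℕ}

theorem keyLT_iff (q p : σ) : KeyLT α β γ q p ↔
    toLex (γ q, toLex (α q, β q)) < toLex (γ p, toLex (α p, β p)) := by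
  simp [KeyLT, Prod.Lex.toLex_lt_toLex]

theorem key_injective (hinj : ∀ p q, γ p = γ q → α p = α q → β p = β q → p = q) :
    Function.Injective fun p => toLex (γ p, toLex (α p, β p)) := by
  intro p q h
  simp only [EmbeddingLike.apply_eq_iff_eq, Prod.mk.injEq] at h
  exact hinj p q h.1 h.2.1 h.2.2

theorem exists_lex_monomialOrder [Finite σ]
    (hinj : ∀ p q, γ p = γ q → α p = α q → β p = β q → p = q) :
    ∃ m : MonomialOrder.{0, 0} σ,
      ∀ d e, d ≺[m] e ↔ ∃ p, (∀ q, KeyLT α β γ q p → d q = e q) ∧ d p < e p := by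
  let _ : LinearOrder σ := LinearOrder.lift' _ (key_injective hinj)
  refine ⟨MonomialOrder.lex, fun d e => ?_⟩
  simp only [keyLT_iff]
  rw [MonomialOrder.lex_lt_iff, Finsupp.Lex.lt_iff]
  rfl

theorem exists_increasing_enumeration
    (hinj : ∀ p q, γ p = γ q → α p = α q → β p = β q → p = q) (C : Finset σ) {N : ℕ}
    (hN : C.card = N) : ∃ c : Fin N → σ, (∀ i i', i < i' → KeyLT α β γ (c i) (c i')) ∧
      (∀ i, c i ∈ C) ∧ ∀ p ∈ C, ∃ i, c i = p := by
  let _ : LinearOrder σ := LinearOrder.lift' _ (key_injective hinj)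
  refine ⟨C.orderEmbOfFin hN, fun i i' hi => ?_, C.orderEmbOfFin_mem hN, fun p hp => ?_⟩
  · rw [keyLT_iff]
    exact (C.orderEmbOfFin hN).strictMono hi
  · have : p ∈ Set.range (C.orderEmbOfFin hN) := by simpa using hp
    exact this
end Key

/-! ### Flattening matrices -/

section Flattening
open scoped MonomialOrder
variable {n : ℕ} (a : Fin n → ℕ) {K : Type*} [Field K]

theorem card_filter_apply_eq (j : Fin n) (z : Fin (a j)) :
    (Finset.univ.filter fun s : (i : Fin n) → Fin (a i) => s j = z).card =
      ∏ i ∈ Finset.univ.erase j, a i := by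
  classical
  have h : (Finset.univ.filter fun s : (i : Fin n) → Fin (a i) => s j = z) =
      Fintype.piFinset (Function.update (β := fun i => Finset (Fin (a i))) (fun i => Finset.univ) j {z}) := by
    ext s
    simp only [Finset.mem_filter, Finset.mem_univ, true_and, Fintype.mem_piFinset]
    constructor
    · intro h i
      by_cases hi : i = j
      · subst hi; simp [h]
      · simp [hi]
    · intro h
      simpa using h j
  rw [h, Fintype.card_piFinset, ← Finset.mul_prod_erase _ _ (Finset.mem_univ j)]
  simp only [Function.update_self, Finset.card_singleton, one_mul]
  refine Finset.prod_congr rfl fun i hi => ?_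
  rw [Function.update_of_ne (Finset.ne_of_mem_erase hi)]
  simp

theorem minors_finite {p q : ℕ} {R : Type*} [CommRing R] (u : ℕ)
    (M : Matrix (Fin p) (Fin q) R) : (minors u M).Finite := by
  refine (Set.finite_range fun x : (Fin u ↪o Fin p) × (Fin u ↪o Fin q) =>
    (M.submatrix x.1 x.2).det).subset ?_
  rintro f ⟨r, c, rfl⟩
  exact ⟨(r, c), rfl⟩

/-- Ordering the columns by `(γ, β)` gives a flattening matrix whose minors have the chains as
leading terms. The relation `L`, on which the monomial order is based, may give precedence to the
row or to the column within a layer of `γ`. -/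
theorem exists_flattening (ha : ∀ i, 0 < a i) (j : Fin n)
    {β γ : ((i : Fin n) → Fin (a i)) → ℕ} (hβ : ∀ s p, β (Function.update s j p) = β s)
    (hγ : ∀ s p, γ (Function.update s j p) = γ s)
    (hinj : ∀ p q : (i : Fin n) → Fin (a i),
      γ p = γ q → (p j : ℕ) = (q j : ℕ) → β p = β q → p = q)
    {L : ((i : Fin n) → Fin (a i)) → ((i : Fin n) → Fin (a i)) → Prop}
    (htrans : ∀ p q r, L p q → L q r → L p r) (hirr : ∀ p, ¬ L p p)
    (m : MonomialOrder ((i : Fin n) → Fin (a i)))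
    (hm : ∀ d e, d ≺[m] e ↔ ∃ p, (∀ q, L q p → d q = e q) ∧ d p < e p)
    (hcol : ∀ q p, q j = p j → γ q < γ p ∨ γ q = γ p ∧ β q < β p → L q p)
    (hrow : ∀ q p, q j < p j → γ q = γ p → β q = β p → L q p) :
    ∃ M : Matrix (Fin (a j)) (Fin (∏ i ∈ Finset.univ.erase j, a i))
        (MvPolynomial ((i : Fin n) → Fin (a i)) K),
      IsFlattening (tensorOfVariables a K) j M ∧
      (∀ (u : ℕ) (c : Fin u → (i : Fin n) → Fin (a i)),
        (∀ i i', i < i' → ChainRel (fun s => (s j : ℕ)) β γ (c i) (c i')) →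
          ∃ g ∈ minors u M, m.leadingTerm g = monomial (∑ i, Finsupp.single (c i) 1) 1) ∧
      ∀ {R : Type _} [CommRing R] (ψ : MvPolynomial ((i : Fin n) → Fin (a i)) K →+* R) {U w : ℕ}
        (A : ℕ → Fin U → R) (B : Fin U → ℕ → ℕ → R),
        (∀ s, ψ (X s) = ∑ i, A (s j) i * B i (β s) (γ s)) → U < w →
          ∀ g ∈ minors w M, ψ g = 0 := by
  classical
  let z : Fin (a j) := ⟨0, ha j⟩
  obtain ⟨c, hc, hcz, hcs⟩ := exists_increasing_enumeration (α := fun s => (s j : ℕ)) hinj _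
    (card_filter_apply_eq a j z)
  have hcz (i) : c i j = z := by simpa using hcz i
  have hlex (i i') (hi : i < i') : γ (c i) < γ (c i') ∨ γ (c i) = γ (c i') ∧ β (c i) < β (c i') := by
    have := hc i i' hi
    simp only [KeyLT, hcz] at this
    omega
  have hidx (s : (i : Fin n) → Fin (a i)) : ∃ q, c q = Function.update s j z :=
    hcs _ (by simp)
  have hupd (s : (i : Fin n) → Fin (a i)) {q} (hq : c q = Function.update s j z) :
      Function.update (c q) j (s j) = s := by simp [hq]
  refine ⟨fun p q => X (Function.update (c q) j p), ⟨fun q => ⟨c q, fun p => rfl⟩, fun s => ?_⟩,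
    fun u d hd => ?_, ?_⟩
  · obtain ⟨q, hq⟩ := hidx s
    exact ⟨s j, q, by simp only [hupd s hq]; rfl⟩
  · choose col hcol' using hidx
    have hβc (s) : β (c (col s)) = β s := by rw [hcol', hβ]
    have hγc (s) : γ (c (col s)) = γ s := by rw [hcol', hγ]
    have hcolmono : StrictMono fun i => col (d i) := by
      intro i i' hi
      have h1 := (hd i i' hi).2
      by_contra! hle
      rw [← hβc, ← hβc (d i'), ← hγc, ← hγc (d i')] at h1
      rcases hle.eq_or_lt with h | h
      · rw [h] at h1; omega
      · have := hlex _ _ h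
        omega
    refine ⟨_, ⟨OrderEmbedding.ofStrictMono (fun i => d i j) fun i i' hi => (hd i i' hi).1,
      OrderEmbedding.ofStrictMono _ hcolmono, rfl⟩, ?_⟩
    have := leadingTerm_det (K := K) htrans hirr m hm
      (fun i i' => Function.update (c (col (d i'))) j (d i j))
      (fun i i' l hi => hrow _ _ (by simpa using (hd i i' hi).1) (by simp only [hγ])
        (by simp only [hβ]))
      (fun l i i' hi => hcol _ _ (by simp) (by
        simp only [hβ, hγ]
        exact hlex _ _ (hcolmono hi)))
    simp only [hupd _ (hcol' _)] at this
    exact this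
  · rintro R _ ψ U w A B hψ hU g ⟨r, q, rfl⟩
    rw [RingHom.map_det]
    convert det_mul_eq_zero_of_lt hU (Matrix.of fun i l => A (r i) l)
      (Matrix.of fun l i => B l (β (c (q i))) (γ (c (q i)))) using 2
    ext i i'
    change ψ (X (Function.update (c (q i')) j (r i))) = _
    rw [hψ]
    simp [Matrix.mul_apply, hβ, hγ]
end Flattening

theorem corollary3 {K : Type*} [Field K] {n : ℕ} (a : Fin n → ℕ) (ha : ∀ i, 0 < a i)
    (j k : Fin n) (u v : ℕ) (hu : 0 < u) (hv : 0 < v) :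
    ∃ (Xj : Matrix (Fin (a j)) (Fin (∏ i ∈ Finset.univ.erase j, a i))
          (MvPolynomial ((i : Fin n) → Fin (a i)) K))
      (Xk : Matrix (Fin (a k)) (Fin (∏ i ∈ Finset.univ.erase k, a i))
          (MvPolynomial ((i : Fin n) → Fin (a i)) K))
      (m : MonomialOrder.{0, 0} ((i : Fin n) → Fin (a i))),
      IsFlattening (tensorOfVariables a K) j Xj ∧
      IsFlattening (tensorOfVariables a K) k Xk ∧
      IsGroebnerBasis m (minors u Xj ∪ minors v Xk) := by
  classical
  have chain_inj {w : ℕ} {α β γ : ((i : Fin n) → Fin (a i)) → ℕ}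
      {c : Fin w → (i : Fin n) → Fin (a i)}
      (hc : ∀ i i', i < i' → ChainRel α β γ (c i) (c i')) : Function.Injective c :=
    (show StrictMono (fun i => α (c i)) from fun i i' hi => (hc i i' hi).1).injective.of_comp
  by_cases hjk : j = k
  · subst hjk
    let α : ((i : Fin n) → Fin (a i)) → ℕ := fun s => s j
    let β : ((i : Fin n) → Fin (a i)) → ℕ := fun _ => 0
    let γ : ((i : Fin n) → Fin (a i)) → ℕ :=
      fun s => Fintype.equivFin _ (Function.update s j (⟨0, ha j⟩ : Fin (a j)))
    have hinj : ∀ p q, γ p = γ q → α p = α q → β p = β q → p = q := by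
      intro p q h1 h2 _
      have h3 := (Fintype.equivFin _).injective (Fin.ext h1)
      funext i
      by_cases hi : i = j
      · subst hi; exact Fin.ext h2
      · simpa [hi] using congrFun h3 i
    obtain ⟨m, hm⟩ := exists_lex_monomialOrder hinj
    -- Only the minors of the smaller size matter, and `β = 0` admits no chain of two points of the
    -- second kind.
    obtain ⟨M, hM, hchain, hker⟩ := exists_flattening (K := K) a ha j (β := β) (γ := γ)
      (fun _ _ => rfl) (fun s p => by simp [γ]) hinj (L := KeyLT α β γ)
      (fun p q r h h' => by unfold KeyLT at *; omega) (fun p h => by unfold KeyLT at h; omega) m hm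
      (fun q p h h' => by have : α q = α p := congrArg Fin.val h; unfold KeyLT; omega)
      (fun q p h h' h'' => by have : α q < α p := h; unfold KeyLT; omega)
    obtain ⟨U, hU⟩ : ∃ U, min u v = U + 1 := ⟨min u v - 1, by omega⟩
    have hfac (s) : (tucker α β γ U 1 K).toRingHom (X s) = ∑ i : Fin U,
        X (Sum.inl (α s, (i : ℕ))) * ∑ l : Fin 1, X (Sum.inr (Sum.inl (β s, (l : ℕ)))) *
          X (Sum.inr (Sum.inr ((i : ℕ), (l : ℕ), γ s))) := by
      change tucker α β γ U 1 K (X s) = _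
      rw [tucker_X]
      simp only [Finset.mul_sum, mul_assoc]
    have hker' (w) (hw : U < w) := hker (tucker α β γ U 1 K).toRingHom
      (fun r i => X (Sum.inl (r, (i : ℕ))))
      (fun i b g => ∑ l : Fin 1, X (Sum.inr (Sum.inl (b, (l : ℕ)))) *
          X (Sum.inr (Sum.inr ((i : ℕ), (l : ℕ), g)))) hfac hw
    refine ⟨M, M, m, hM, hM, isGroebnerBasis_of_forall_ker m
      ((minors_finite _ _).union (minors_finite _ _)) (tucker α β γ U 1 K).toRingHom ?_ ?_⟩
    · rintro g (hg | hg)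
      · exact hker' u (by omega) g hg
      · exact hker' v (by omega) g hg
    · intro f hf h0
      rcases exists_chain_of_tucker_eq_zero m hm hinj hf h0 with ⟨c, hcM, hc⟩ | ⟨c, -, hc⟩
      · obtain ⟨g, hg, hlt⟩ := hchain _ c hc
        refine ⟨g, ?_, _, sum_single_le (chain_inj hc) hcM, hlt⟩
        rcases min_choice u v with h | h
        · exact Or.inl (by rwa [← hU, h] at hg)
        · exact Or.inr (by rwa [← hU, h] at hg)
      · exact absurd (hc 0 1 (by simp)).1 (lt_irrefl 0)
  · let α : ((i : Fin n) → Fin (a i)) → ℕ := fun s => s j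
    let β : ((i : Fin n) → Fin (a i)) → ℕ := fun s => s k
    let γ : ((i : Fin n) → Fin (a i)) → ℕ := fun s => Fintype.equivFin _
      (Function.update (Function.update s j (⟨0, ha j⟩ : Fin (a j))) k (⟨0, ha k⟩ : Fin (a k)))
    have hinj : ∀ p q, γ p = γ q → α p = α q → β p = β q → p = q := by
      intro p q h1 h2 h2'
      have h3 := (Fintype.equivFin _).injective (Fin.ext h1)
      funext i
      by_cases hi : i = j
      · subst hi; exact Fin.ext h2
      by_cases hi' : i = k
      · subst hi'; exact Fin.ext h2'
      · simpa [hi, hi'] using congrFun h3 i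
    have hγj (s) (p) : γ (Function.update s j p) = γ s := by simp [γ]
    have hγk (s) (p) : γ (Function.update s k p) = γ s := by
      simp only [γ, Function.update_comm (Ne.symm hjk), Function.update_idem]
    have hβ (s) (p) : β (Function.update s j p) = β s := by simp [β, Ne.symm hjk]
    have hα (s) (p) : α (Function.update s k p) = α s := by simp [α, hjk]
    obtain ⟨m, hm⟩ := exists_lex_monomialOrder hinj
    have htrans (p q r) (h : KeyLT α β γ p q) (h' : KeyLT α β γ q r) : KeyLT α β γ p r := by
      unfold KeyLT at *; omega
    have hirr (p) (h : KeyLT α β γ p p) : False := by unfold KeyLT at h; omega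
    obtain ⟨Xj, hXj, hchain, hker⟩ := exists_flattening (K := K) a ha j hβ hγj hinj
      htrans hirr m hm
      (fun q p h h' => by have : α q = α p := congrArg Fin.val h; unfold KeyLT; omega)
      (fun q p h h' h'' => by have : α q < α p := h; unfold KeyLT; omega)
    obtain ⟨Xk, hXk, hchain', hker'⟩ := exists_flattening (K := K) a ha k hα hγk
      (fun p q h1 h2 h3 => hinj p q h1 h3 h2) htrans hirr m hm
      (fun q p h h' => by have : β q = β p := congrArg Fin.val h; unfold KeyLT; omega)
      (fun q p h h' h'' => by have : β q < β p := h; unfold KeyLT; omega)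
    obtain ⟨U, rfl⟩ : ∃ U, u = U + 1 := ⟨u - 1, by omega⟩
    obtain ⟨V, rfl⟩ : ∃ V, v = V + 1 := ⟨v - 1, by omega⟩
    refine ⟨Xj, Xk, m, hXj, hXk, isGroebnerBasis_of_forall_ker m
      ((minors_finite _ _).union (minors_finite _ _)) (tucker α β γ U V K).toRingHom ?_ ?_⟩
    · rintro g (hg | hg)
      · refine hker (tucker α β γ U V K).toRingHom (fun r i => X (Sum.inl (r, (i : ℕ))))
          (fun i b g => ∑ l : Fin V, X (Sum.inr (Sum.inl (b, (l : ℕ)))) *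
            X (Sum.inr (Sum.inr ((i : ℕ), (l : ℕ), g)))) (fun s => ?_) (Nat.lt_succ_self U) g hg
        change tucker α β γ U V K (X s) = _
        rw [tucker_X]
        simp only [Finset.mul_sum, mul_assoc]
        rfl
      · refine hker' (tucker α β γ U V K).toRingHom (fun r l => X (Sum.inr (Sum.inl (r, (l : ℕ)))))
          (fun l b g => ∑ i : Fin U, X (Sum.inl (b, (i : ℕ))) *
            X (Sum.inr (Sum.inr ((i : ℕ), (l : ℕ), g)))) (fun s => ?_) (Nat.lt_succ_self V) g hg
        change tucker α β γ U V K (X s) = _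
        rw [tucker_X, Finset.sum_comm]
        simp only [Finset.mul_sum, mul_assoc]
        exact Finset.sum_congr rfl fun l _ => Finset.sum_congr rfl fun i _ => mul_left_comm _ _ _
    · intro f hf h0
      rcases exists_chain_of_tucker_eq_zero m hm hinj hf h0 with ⟨c, hcM, hc⟩ | ⟨c, hcM, hc⟩
      · obtain ⟨g, hg, hlt⟩ := hchain _ c hc
        exact ⟨g, Or.inl hg, _, sum_single_le (chain_inj hc) hcM, hlt⟩
      · obtain ⟨g, hg, hlt⟩ := hchain' _ c hc
        exact ⟨g, Or.inr hg, _, sum_single_le (chain_inj hc) hcM, hlt⟩
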